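/- Let $(M,\nabla,g)$ be a compact connected Hessian manifold (without boundary) of dimension $n$: that is, $M$ is a compact connected smooth manifold, $\nabla$ is a smooth flat torsion-free connection on $TM$, and $g$ is a smooth Riemannian metric on $M$ which near every point can be written as $g=\nabla d\psi$ for some smooth function $\psi$, where $(\nabla d\psi)(X,Y)=X(Y\psi)-(\nabla_XY)\psi$. Then for every real number $K$ there is a constant $C$, depending only on $K$ and on $(M,\nabla,g)$, with the following property. If $\phi\in C^2(M)$ and $f:M\to\mathbb{R}$ satisfy $$g+\nabla d\phi>0,\qquad \det(g+\nabla d\phi)=f\det g \quad\text{on } M,$$ where $>0$ means positive definite at every point and the determinants are those of the component matrices in any basis of the tangent space, and if $\|f\|_{L^\infty(M)}\le K$, then $$\operatorname{osc}_M\phi:=\sup_M\phi-\inf_M\phi\le C.$$ -/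

import Mathlib

open Bundle
open scoped Manifold ContDiff Topology

namespace HessianGeometry

section

variable {n : ℕ} {M : Type*} [TopologicalSpace M] [ChartedSpace (EuclideanSpace ℝ (Fin n)) M]
  [IsManifold (𝓡 n) ∞ M]

/-- The flatness of a connection `∇` on the tangent bundle: the curvature
`R(X, Y)Z = ∇_X ∇_Y Z - ∇_Y ∇_X Z - ∇_{[X, Y]} Z` vanishes for all smooth vector fields `X, Y, Z`.
Mathlib writes `(∇_X Z)(x)` as `cov Z x (X x)`. -/
def IsFlat
    (cov : CovariantDerivative (𝓡 n) (EuclideanSpace ℝ (Fin n))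
      (TangentSpace (𝓡 n) : M → Type _)) : Prop :=
  ∀ X Y Z : (x : M) → TangentSpace (𝓡 n) x,
    ContMDiff (𝓡 n) (𝓡 n).tangent ∞ (fun x => (⟨x, X x⟩ : TangentBundle (𝓡 n) M)) →
    ContMDiff (𝓡 n) (𝓡 n).tangent ∞ (fun x => (⟨x, Y x⟩ : TangentBundle (𝓡 n) M)) →
    ContMDiff (𝓡 n) (𝓡 n).tangent ∞ (fun x => (⟨x, Z x⟩ : TangentBundle (𝓡 n) M)) →
    ∀ x : M,
      cov (fun y => cov Z y (Y y)) x (X x) - cov (fun y => cov Z y (X y)) x (Y x)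
        - cov Z x (VectorField.mlieBracket (𝓡 n) X Y x) = 0

/-- The bilinear form `(∇dφ)_x(v, w) = v(W φ) - (∇_v W) φ` on `T_x M`, where `W` is a vector
field, smooth near `x`, with `W x = w`. For `φ` of class `C²` near `x` it does not depend on the
extension `W` of `w`; `FiberBundle.extend` is one (constant in the chart at `x`). -/
noncomputable def hessian
    (cov : CovariantDerivative (𝓡 n) (EuclideanSpace ℝ (Fin n))
      (TangentSpace (𝓡 n) : M → Type _))
    (φ : M → ℝ) (x : M) (v w : TangentSpace (𝓡 n) x) : ℝ :=
  mvfderiv (𝓡 n)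
      (fun y : M => mvfderiv (𝓡 n) φ y (FiberBundle.extend (EuclideanSpace ℝ (Fin n)) w y)) x v
    - mvfderiv (𝓡 n) φ x (cov (FiberBundle.extend (EuclideanSpace ℝ (Fin n)) w) x v)

/-- `(M, ∇, g)` is a Hessian manifold: `∇` is a smooth, torsion-free and flat connection on `TM`,
and the smooth Riemannian metric `g` is locally `∇dψ` for smooth functions `ψ`. -/
structure IsHessianManifold
    (cov : CovariantDerivative (𝓡 n) (EuclideanSpace ℝ (Fin n))
      (TangentSpace (𝓡 n) : M → Type _))
    (g : ContMDiffRiemannianMetric (𝓡 n) ∞ (EuclideanSpace ℝ (Fin n))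
      (TangentSpace (𝓡 n) : M → Type _)) : Prop where
  smooth : CovariantDerivative.ContMDiffCovariantDerivative cov ∞
  torsion_free : ∀ x : M, cov.torsion x = 0
  flat : IsFlat cov
  locally_hessian : ∀ p : M, ∃ U : Set M, IsOpen U ∧ p ∈ U ∧ ∃ ψ : M → ℝ,
    ContMDiffOn (𝓡 n) 𝓘(ℝ, ℝ) ∞ ψ U ∧
      ∀ x ∈ U, ∀ v w : TangentSpace (𝓡 n) x, g.inner x v w = hessian cov ψ x v w

/-- The bilinear form `g + ∇dφ` on `T_x M`. -/
noncomputable def deformedMetric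
    (cov : CovariantDerivative (𝓡 n) (EuclideanSpace ℝ (Fin n))
      (TangentSpace (𝓡 n) : M → Type _))
    (g : ContMDiffRiemannianMetric (𝓡 n) ∞ (EuclideanSpace ℝ (Fin n))
      (TangentSpace (𝓡 n) : M → Type _))
    (φ : M → ℝ) (x : M) (v w : TangentSpace (𝓡 n) x) : ℝ :=
  g.inner x v w + hessian cov φ x v w

/-- `det (g + ∇dφ) = f det g`: the equation holds at every point between the determinants of the
component matrices in every basis of the tangent space. (Both sides are multiplied by the same
nonzero factor under a change of basis.) -/
def SolvesMongeAmpere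
    (cov : CovariantDerivative (𝓡 n) (EuclideanSpace ℝ (Fin n))
      (TangentSpace (𝓡 n) : M → Type _))
    (g : ContMDiffRiemannianMetric (𝓡 n) ∞ (EuclideanSpace ℝ (Fin n))
      (TangentSpace (𝓡 n) : M → Type _))
    (φ f : M → ℝ) : Prop :=
  ∀ (x : M) (b : Module.Basis (Fin n) ℝ (TangentSpace (𝓡 n) x)),
    (Matrix.of fun i j => deformedMetric cov g φ x (b i) (b j)).det =
      f x * (Matrix.of fun i j => g.inner x (b i) (b j)).det

end

end HessianGeometry

namespace HessianGeometry

/-! Put F = 1 + max φ - φ ≥ 1. In a chart, positivity of g + ∇dφ bounds the second derivatives of F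
above by C(1 + |DF|), with C independent of φ (`exists_second_deriv_lower_bound`). Such an F cannot
be steep relative to its size: following the direction of steepest descent, the upper bound on F''
leaves too little room to turn before F drops below 1. Hence |DF| ≤ A F in the interior
(`exists_norm_fderiv_le_mul`), so log F is Lipschitz and F satisfies a Harnack inequality on small
balls (`exists_local_harnack`).

Compactness and connectedness chain these into F x ≤ A * F y on all of M
(`exists_harnack_of_local`). At a maximum point of φ one has F = 1, so F ≤ A everywhere and osc φ ≤
A - 1. -/

/-! ### A differential inequality in one variable. -/

lemma le_of_hasDerivAt_nonpos {f f' : ℝ → ℝ} {T : ℝ}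
    (hf : ∀ t ∈ Set.Icc 0 T, HasDerivAt f (f' t) t) (hf' : ∀ t ∈ Set.Icc 0 T, f' t ≤ 0)
    {t : ℝ} (ht : t ∈ Set.Icc 0 T) : f t ≤ f 0 := by
  refine antitoneOn_of_deriv_nonpos (convex_Icc 0 T)
    (fun s hs => (hf s hs).continuousAt.continuousWithinAt)
    (fun s hs => (hf s (interior_subset hs)).differentiableAt.differentiableWithinAt)
    (fun s hs => ?_) ⟨le_rfl, ht.1.trans ht.2⟩ ht ht.1
  rw [(hf s (interior_subset hs)).deriv]
  exact hf' s (interior_subset hs)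

/-- A function `h ≥ 1` on `[0, 2 / a]` whose logarithmic derivative is at most `2 a`, and is `-a`
at `0`, cannot satisfy `h'' ≤ C (1 + 2 a h)` when `a` is large. -/
lemma slope_le_of_deriv2_le {h h' h'' : ℝ → ℝ} {a C : ℝ} (ha : 0 < a) (hC : 0 ≤ C)
    (hd : ∀ t ∈ Set.Icc 0 (2 / a), HasDerivAt h (h' t) t)
    (hd' : ∀ t ∈ Set.Icc 0 (2 / a), HasDerivAt h' (h'' t) t)
    (h1 : ∀ t ∈ Set.Icc 0 (2 / a), 1 ≤ h t)
    (hb : ∀ t ∈ Set.Icc 0 (2 / a), h' t ≤ 2 * a * h t)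
    (hc : ∀ t ∈ Set.Icc 0 (2 / a), h'' t ≤ C * (1 + 2 * a * h t))
    (h0 : h' 0 = -a * h 0) :
    a ≤ 1 + 2 * C + 4 * C * Real.exp 4 := by
  by_contra! hlt
  have hT : (0 : ℝ) ≤ 2 / a := by positivity
  have hmem0 : (0 : ℝ) ∈ Set.Icc 0 (2 / a) := ⟨le_rfl, hT⟩
  have hh0 := h1 0 hmem0
  -- Grönwall: h(t) exp(-2at) is nonincreasing, and 2at ≤ 4 on the interval.
  have hup : ∀ t ∈ Set.Icc 0 (2 / a), h t ≤ Real.exp 4 * h 0 := by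
    intro t ht
    have key := le_of_hasDerivAt_nonpos (f := fun t => h t * Real.exp (-(2 * a) * t))
      (f' := fun t => h' t * Real.exp (-(2 * a) * t) +
        h t * (Real.exp (-(2 * a) * t) * (-(2 * a)))) (T := 2 / a)
      (fun s hs => (hd s hs).mul (((hasDerivAt_id s).const_mul (-(2 * a))).exp.congr_deriv (by simp)))
      (fun s hs => by
        have := hb s hs
        have he := Real.exp_pos (-(2 * a) * s)
        nlinarith) ht
    simp only [mul_zero, Real.exp_zero, mul_one] at key
    have hat : 2 * a * t ≤ 4 := by
      have := ht.2
      rw [le_div_iff₀ ha] at this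
      nlinarith
    have e1 : h t = h t * Real.exp (-(2 * a) * t) * Real.exp (2 * a * t) := by
      rw [mul_assoc, ← Real.exp_add]; simp
    rw [e1, mul_comm (Real.exp 4)]
    exact mul_le_mul key (Real.exp_le_exp.2 hat) (Real.exp_pos _).le (by linarith)
  set B := C * (1 + 2 * a * (Real.exp 4 * h 0)) with hB
  have hcB : ∀ t ∈ Set.Icc 0 (2 / a), h'' t ≤ B := fun t ht =>
    (hc t ht).trans (by have := hup t ht; rw [hB]; gcongr)
  have hslope : ∀ t ∈ Set.Icc 0 (2 / a), h' t ≤ -a * h 0 + B * t := by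
    intro t ht
    have key := le_of_hasDerivAt_nonpos (f := fun t => h' t - B * t) (f' := fun t => h'' t - B)
      (T := 2 / a) (fun s hs => ((hd' s hs).sub ((hasDerivAt_id s).const_mul B)).congr_deriv
        (by simp)) (fun s hs => by have := hcB s hs; linarith) ht
    simp only [mul_zero] at key
    linarith
  have hval := le_of_hasDerivAt_nonpos (f := fun t => h t - (-a * h 0 * t + B / 2 * t ^ 2))
      (f' := fun t => h' t - (-a * h 0 + B * t))
      (T := 2 / a) (fun s hs => ((hd s hs).sub (((hasDerivAt_id s).const_mul (-a * h 0)).add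
        ((hasDerivAt_pow 2 s).const_mul (B / 2)))).congr_deriv (by simp; ring))
      (fun s hs => by have := hslope s hs; linarith) (t := 2 / a) ⟨hT, le_rfl⟩
  have hend := h1 (2 / a) ⟨hT, le_rfl⟩
  have e2 : -a * h 0 * (2 / a) + B / 2 * (2 / a) ^ 2 = -2 * h 0 + 2 * B / a ^ 2 := by
    field_simp
  simp only [e2] at hval
  -- The threshold on a is what makes 2B ≤ a² h(0), given h(0) ≥ 1 and a ≥ 1. Then h(2/a) ≤ -h(0) +
  -- 2B/a² ≤ 0, against h ≥ 1.
  have hBa : 2 * B / a ^ 2 ≤ h 0 := by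
    rw [div_le_iff₀ (by positivity), hB]
    have hE := Real.exp_pos 4
    have hCE : 0 ≤ C * Real.exp 4 := by positivity
    have ha1 : 1 ≤ a := by nlinarith
    have s1 : 2 * C ≤ 2 * C * h 0 * a := by nlinarith [mul_nonneg hC (by linarith : (0:ℝ) ≤ h 0)]
    have s2 : (2 * C + 4 * C * Real.exp 4) * (h 0 * a) ≤ a * (h 0 * a) := by
      gcongr; linarith
    nlinarith
  norm_num at hval
  linarith

/-! ### Gradient estimate and Harnack inequality on Euclidean balls. -/

section

variable {E : Type*} [NormedAddCommGroup E] [InnerProductSpace ℝ E] [FiniteDimensional ℝ E]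

lemma exists_norm_eq_one_apply_eq_neg_norm {L : E →L[ℝ] ℝ} (hL : L ≠ 0) :
    ∃ v : E, ‖v‖ = 1 ∧ L v = -‖L‖ := by
  set w := (InnerProductSpace.toDual ℝ E).symm L with hw
  have hnorm : ‖w‖ = ‖L‖ := LinearIsometryEquiv.norm_map _ _
  have hL0 : ‖L‖ ≠ 0 := norm_ne_zero_iff.2 hL
  refine ⟨-(‖w‖⁻¹ • w), ?_, ?_⟩
  · rw [norm_neg, norm_smul, norm_inv, norm_norm, inv_mul_cancel₀ (hnorm ▸ hL0)]
  · have : L w = ‖w‖ ^ 2 := by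
      rw [← real_inner_self_eq_norm_sq, ← InnerProductSpace.toDual_apply_apply (𝕜 := ℝ)]
      simp [hw]
    rw [map_neg, map_smul, this, hnorm, smul_eq_mul]
    field_simp

/-- An interior gradient estimate `|DF| ≤ A F` for functions `F ≥ 1` whose second derivatives are
bounded above by `C (1 + |DF|)`. -/
lemma exists_norm_fderiv_le_mul {C r : ℝ} (hC : 0 ≤ C) (hr : 0 < r) :
    ∃ A : ℝ, ∀ (F : E → ℝ) (c : E),
      (∀ x ∈ Metric.closedBall c r, DifferentiableAt ℝ F x) →
      ContinuousOn (fderiv ℝ F) (Metric.closedBall c r) →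
      (∀ x ∈ Metric.closedBall c r, 1 ≤ F x) →
      (∀ x ∈ Metric.closedBall c r, ∀ v : E, ‖v‖ = 1 →
        ∃ d : ℝ, HasDerivAt (fun s : ℝ => fderiv ℝ F (x + s • v) v) d 0 ∧
          d ≤ C * (1 + ‖fderiv ℝ F x‖)) →
      ∀ x ∈ Metric.closedBall c (r / 2), ‖fderiv ℝ F x‖ ≤ A * F x := by
  set A₀ := 1 + 2 * C + 4 * C * Real.exp 4 with hA₀
  have hA₀pos : 0 < A₀ := by positivity
  refine ⟨2 * (4 / r + A₀), fun F c hF hF' h1 h2 x hx => ?_⟩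
  -- The weight r - |x - c| vanishes on the boundary sphere, so a positive maximum is interior; the
  -- estimate reduces to bounding this maximum m.
  obtain ⟨z, hz, hmax⟩ := (isCompact_closedBall c r).exists_isMaxOn ⟨c, by simp [hr.le]⟩
    (f := fun x => (r - dist x c) * ‖fderiv ℝ F x‖ / F x) (by
      refine ContinuousOn.div (((continuous_const.sub
        (continuous_id.dist continuous_const)).continuousOn).mul hF'.norm)
        (fun y hy => (hF y hy).continuousAt.continuousWithinAt)
        (fun y hy => by have := h1 y hy; positivity))
  set m := (r - dist z c) * ‖fderiv ℝ F z‖ / F z with hm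
  have hmle : ∀ y ∈ Metric.closedBall c r, (r - dist y c) * ‖fderiv ℝ F y‖ ≤ m * F y := by
    intro y hy
    have h := hmax hy
    have h1y := h1 y hy
    simp only [Set.mem_ofPred_eq] at h
    rwa [div_le_iff₀ (by linarith)] at h
  have hmbound : m ≤ 4 + A₀ * r := by
    by_contra! hlt
    have hm0 : 0 < m := by have : 0 ≤ A₀ * r := by positivity
                           linarith
    have hFz := h1 z hz
    set δ := r - dist z c with hδ
    have hδ0 : 0 < δ := by
      have h0 : 0 ≤ δ := by rw [hδ]; have := Metric.mem_closedBall.1 hz; linarith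
      rcases h0.lt_or_eq with h | h
      · exact h
      · rw [← h] at hm; simp at hm; linarith
    have hδr : δ ≤ r := by rw [hδ]; have := dist_nonneg (x := z) (y := c); linarith
    set a := m / δ with ha
    have ha0 : 0 < a := by positivity
    have hnz : ‖fderiv ℝ F z‖ = a * F z := by
      rw [ha, hm]; field_simp
    have hLne : fderiv ℝ F z ≠ 0 := by
      rw [← norm_ne_zero_iff, hnz]; positivity
    obtain ⟨v, hv, hLv⟩ := exists_norm_eq_one_apply_eq_neg_norm hLne
    -- Here m > 4 is used: the descent segment of length 2/a stays within δ/2 of z, where the weight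
    -- is at least δ/2. Maximality at z then costs only a factor 2 in `hgrad`.
    have hT : 2 / a ≤ δ / 2 := by
      rw [ha, div_div_eq_mul_div, div_le_div_iff₀ hm0 two_pos]
      have : 0 ≤ A₀ * r := by positivity
      nlinarith
    have hdist : ∀ t ∈ Set.Icc 0 (2 / a), dist (z + t • v) c ≤ r - δ / 2 := by
      intro t ht
      calc dist (z + t • v) c ≤ dist (z + t • v) z + dist z c := dist_triangle _ _ _
        _ = t + dist z c := by simp [dist_eq_norm, norm_smul, hv, abs_of_nonneg ht.1]
        _ ≤ r - δ / 2 := by have := ht.2; rw [hδ] at hT ⊢; linarith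
    have hin : ∀ t ∈ Set.Icc 0 (2 / a), z + t • v ∈ Metric.closedBall c r := fun t ht =>
      Metric.mem_closedBall.2 ((hdist t ht).trans (by linarith))
    have hgrad : ∀ t ∈ Set.Icc 0 (2 / a), ‖fderiv ℝ F (z + t • v)‖ ≤ 2 * a * F (z + t • v) := by
      intro t ht
      have h := hmle _ (hin t ht)
      have h' : δ / 2 * ‖fderiv ℝ F (z + t • v)‖ ≤ m * F (z + t • v) :=
        (mul_le_mul_of_nonneg_right (by have := hdist t ht; linarith) (norm_nonneg _)).trans h
      have : m = a * δ := by rw [ha]; field_simp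
      rw [this] at h'
      nlinarith
    have hline : ∀ t : ℝ, HasDerivAt (fun s : ℝ => z + s • v) v t := fun t => by
      simpa using ((hasDerivAt_id t).smul_const v).const_add z
    -- Membership of t sits under the existential so that `choose` yields a total function h''.
    have hd2 : ∀ t : ℝ, ∃ d : ℝ, t ∈ Set.Icc 0 (2 / a) →
        HasDerivAt (fun s : ℝ => fderiv ℝ F (z + s • v) v) d t ∧
          d ≤ C * (1 + ‖fderiv ℝ F (z + t • v)‖) := by
      intro t
      by_cases ht : t ∈ Set.Icc 0 (2 / a)
      · obtain ⟨d, hd, hdle⟩ := h2 _ (hin t ht) v hv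
        refine ⟨d, fun _ => ⟨?_, hdle⟩⟩
        have hd0 : HasDerivAt (fun s : ℝ => fderiv ℝ F (z + t • v + s • v) v) d (t - t) := by
          rwa [sub_self]
        have := hd0.comp_sub_const t t
        refine this.congr_of_eventuallyEq (.of_forall fun s => ?_)
        simp only []
        rw [add_assoc, ← add_smul, add_sub_cancel]
      · exact ⟨0, fun h => absurd h ht⟩
    choose h'' hh'' using hd2
    have := slope_le_of_deriv2_le (h := fun t => F (z + t • v))
      (h' := fun t => fderiv ℝ F (z + t • v) v) (h'' := h'') ha0 hC
      (fun t ht => (hF _ (hin t ht)).hasFDerivAt.comp_hasDerivAt t (hline t))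
      (fun t ht => (hh'' t ht).1) (fun t ht => h1 _ (hin t ht))
      (fun t ht => by
        refine (le_trans (le_abs_self _) ?_).trans (hgrad t ht)
        simpa [hv] using (fderiv ℝ F (z + t • v)).le_opNorm v)
      (fun t ht => (hh'' t ht).2.trans (by have := hgrad t ht; gcongr))
      (by simp [hLv, hnz])
    have h3 : m ≤ A₀ * δ := by rw [ha, div_le_iff₀ hδ0] at this; exact this
    have h4 : A₀ * δ ≤ A₀ * r := by gcongr
    linarith
  have hxr : x ∈ Metric.closedBall c r := Metric.closedBall_subset_closedBall (by linarith) hx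
  have h3 := hmle x hxr
  have h1x := h1 x hxr
  have h4 : r / 2 * ‖fderiv ℝ F x‖ ≤ (4 + A₀ * r) * F x :=
    ((mul_le_mul_of_nonneg_right (by have := Metric.mem_closedBall.1 hx; linarith)
      (norm_nonneg _)).trans h3).trans (by gcongr)
  calc ‖fderiv ℝ F x‖ = 2 / r * (r / 2 * ‖fderiv ℝ F x‖) := by field_simp
    _ ≤ 2 / r * ((4 + A₀ * r) * F x) := by gcongr
    _ = 2 * (4 / r + A₀) * F x := by field_simp

/-- A Harnack inequality on half of a ball for functions `F ≥ 1` whose second derivatives are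
bounded above by `C (1 + |DF|)`. -/
lemma exists_le_mul_of_second_deriv_le {C r : ℝ} (hC : 0 ≤ C) (hr : 0 < r) :
    ∃ A : ℝ, ∀ (F : E → ℝ) (c : E),
      (∀ x ∈ Metric.closedBall c r, DifferentiableAt ℝ F x) →
      ContinuousOn (fderiv ℝ F) (Metric.closedBall c r) →
      (∀ x ∈ Metric.closedBall c r, 1 ≤ F x) →
      (∀ x ∈ Metric.closedBall c r, ∀ v : E, ‖v‖ = 1 →
        ∃ d : ℝ, HasDerivAt (fun s : ℝ => fderiv ℝ F (x + s • v) v) d 0 ∧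
          d ≤ C * (1 + ‖fderiv ℝ F x‖)) →
      ∀ x ∈ Metric.closedBall c (r / 2), ∀ y ∈ Metric.closedBall c (r / 2), F x ≤ A * F y := by
  obtain ⟨A, hA⟩ := exists_norm_fderiv_le_mul (E := E) hC hr
  refine ⟨Real.exp (A * r), fun F c hF hF' h1 h2 x hx y hy => ?_⟩
  have hsub : Metric.closedBall c (r / 2) ⊆ Metric.closedBall c r :=
    Metric.closedBall_subset_closedBall (by linarith)
  have hx1 := h1 x (hsub hx)
  have hy1 := h1 y (hsub hy)
  have hgrad := hA F c hF hF' h1 h2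
  have hA0 : 0 ≤ A := by
    have := (norm_nonneg _).trans (hgrad x hx)
    exact nonneg_of_mul_nonneg_left this (by linarith)
  -- The gradient estimate says |D log F| ≤ A; integrate over the convex half ball.
  have hlog : ‖Real.log (F x) - Real.log (F y)‖ ≤ A * ‖x - y‖ := by
    refine Convex.norm_image_sub_le_of_norm_hasFDerivWithin_le (s := Metric.closedBall c (r / 2))
      (f := fun x => Real.log (F x)) (f' := fun x => (F x)⁻¹ • fderiv ℝ F x)
      (fun w hw => ?_) (fun w hw => ?_) (convex_closedBall _ _) hy hx
    · exact ((hF w (hsub hw)).hasFDerivAt.log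
        (by have := h1 w (hsub hw); positivity)).hasFDerivWithinAt
    · have := h1 w (hsub hw)
      rw [norm_smul, norm_inv, Real.norm_of_nonneg (by linarith), inv_mul_le_iff₀ (by linarith),
        mul_comm]
      exact hgrad w hw
  have hxy : ‖x - y‖ ≤ r := by
    rw [← dist_eq_norm]
    have h3 := Metric.mem_closedBall.1 hx
    have h4 := Metric.mem_closedBall'.1 hy
    linarith [dist_triangle x c y]
  have h5 : Real.log (F x) ≤ A * r + Real.log (F y) := by
    have := (le_abs_self _).trans (hlog.trans (mul_le_mul_of_nonneg_left hxy hA0))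
    linarith
  calc F x = Real.exp (Real.log (F x)) := (Real.exp_log (by linarith)).symm
    _ ≤ Real.exp (A * r + Real.log (F y)) := Real.exp_le_exp.2 h5
    _ = Real.exp (A * r) * F y := by rw [Real.exp_add, Real.exp_log (by linarith)]

end

/-! ### The Hessian in charts and the local Harnack inequality on M. -/

section
variable {n : ℕ} {M : Type*} [TopologicalSpace M] [ChartedSpace (EuclideanSpace ℝ (Fin n)) M]
  [IsManifold (𝓡 n) ∞ M]

/-- The function is the fibre component of `tangentMap φ` composed with the section W, and the
tangent map of a C² function is C¹. -/
lemma mdifferentiableAt_mvfderiv_apply {φ : M → ℝ} (hφ : ContMDiff (𝓡 n) 𝓘(ℝ, ℝ) 2 φ)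
    {W : (x : M) → TangentSpace (𝓡 n) x} {x : M}
    (hW : MDifferentiableAt (𝓡 n) (𝓡 n).tangent
      (fun x => (⟨x, W x⟩ : TangentBundle (𝓡 n) M)) x) :
    MDifferentiableAt (𝓡 n) 𝓘(ℝ, ℝ) (fun y => mvfderiv (𝓡 n) φ y (W y)) x := by
  have h1 : ContMDiff (𝓡 n).tangent 𝓘(ℝ, ℝ).tangent 1 (tangentMap (𝓡 n) 𝓘(ℝ, ℝ) φ) :=
    hφ.contMDiff_tangentMap le_rfl
  have h2 : ContMDiff 𝓘(ℝ, ℝ).tangent 𝓘(ℝ, ℝ) 1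
      (fun p : TangentBundle 𝓘(ℝ, ℝ) ℝ => (p.2 : ℝ)) :=
    contMDiff_snd_tangentBundle_modelSpace ℝ 𝓘(ℝ, ℝ)
  exact ((h2.comp h1).mdifferentiable one_ne_zero _).comp x hW

/-- The Hessian may be computed with any extension of the second vector. -/
lemma hessian_eq_of_extension
    (cov : CovariantDerivative (𝓡 n) (EuclideanSpace ℝ (Fin n))
      (TangentSpace (𝓡 n) : M → Type _))
    {φ : M → ℝ} (hφ : ContMDiff (𝓡 n) 𝓘(ℝ, ℝ) 2 φ)
    {W : (x : M) → TangentSpace (𝓡 n) x} {x : M}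
    (hW : MDifferentiableAt (𝓡 n) (𝓡 n).tangent
      (fun x => (⟨x, W x⟩ : TangentBundle (𝓡 n) M)) x) (v : TangentSpace (𝓡 n) x) :
    hessian cov φ x v (W x) =
      mvfderiv (𝓡 n) (fun y => mvfderiv (𝓡 n) φ y (W y)) x v
        - mvfderiv (𝓡 n) φ x (cov W x v) := by
  -- Replacing W by f W produces the extra term df(v) dφ(W) in both summands, where it cancels. The
  -- expression is therefore tensorial in W and depends only on W x.
  have hΦ : TensorialAt (𝓡 n) (EuclideanSpace ℝ (Fin n))
      (fun W : (x : M) → TangentSpace (𝓡 n) x =>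
        mvfderiv (𝓡 n) (fun y => mvfderiv (𝓡 n) φ y (W y)) x v
          - mvfderiv (𝓡 n) φ x (cov W x v)) x := by
    constructor
    · intro f σ hf hσ
      have h1 : (fun y => mvfderiv (𝓡 n) φ y ((f • σ) y)) =
          f * (fun y => mvfderiv (𝓡 n) φ y (σ y)) := by
        ext y; simp
      have h2 := cov.isCovariantDerivativeOn.leibniz (s := Set.univ) hσ hf
      rw [h1, mvfderiv_mul hf (mdifferentiableAt_mvfderiv_apply hφ hσ), h2]
      simp
      ring
    · intro σ σ' hσ hσ'
      have h1 : (fun y => mvfderiv (𝓡 n) φ y ((σ + σ') y)) =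
          (fun y => mvfderiv (𝓡 n) φ y (σ y)) + (fun y => mvfderiv (𝓡 n) φ y (σ' y)) := by
        ext y; simp
      have h2 := cov.isCovariantDerivativeOn.add (s := Set.univ) hσ hσ'
      rw [h1, mvfderiv_add (mdifferentiableAt_mvfderiv_apply hφ hσ)
        (mdifferentiableAt_mvfderiv_apply hφ hσ'), h2]
      simp
      ring
  exact hΦ.pointwise (FiberBundle.mdifferentiableAt_extend ..) hW (by simp)

/-- Around every point there are global smooth vector fields which near the point are the
coordinate fields of the preferred chart. -/
lemma exists_contMDiff_coordinate_fields [T2Space M] (p : M) :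
    ∃ X : Fin n → (x : M) → TangentSpace (𝓡 n) x,
      (∀ i, ContMDiff (𝓡 n) (𝓡 n).tangent ∞
        (fun x => (⟨x, X i x⟩ : TangentBundle (𝓡 n) M))) ∧
      ∀ᶠ y in 𝓝 p, ∀ i, X i y =
        (trivializationAt (EuclideanSpace ℝ (Fin n)) (TangentSpace (𝓡 n) : M → Type _) p).symmL ℝ y
          (EuclideanSpace.basisFun (Fin n) ℝ i) := by
  set e := trivializationAt (EuclideanSpace ℝ (Fin n)) (TangentSpace (𝓡 n) : M → Type _) p
  have hbase : e.baseSet = (chartAt (EuclideanSpace ℝ (Fin n)) p).source :=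
    TangentBundle.trivializationAt_baseSet p
  let b := (EuclideanSpace.basisFun (Fin n) ℝ).toBasis
  obtain ⟨χ⟩ : Nonempty (SmoothBumpFunction (𝓡 n) p) := inferInstance
  refine ⟨fun i => (χ : M → ℝ) • e.localFrame b i, fun i => ?_, ?_⟩
  · refine ContMDiffOn.smul_section_of_tsupport (u := e.baseSet) χ.contMDiff.contMDiffOn
      e.open_baseSet (by rw [hbase]; exact χ.tsupport_subset_chartAt_source) ?_
    exact e.contMDiffOn_localFrame_baseSet ∞ b i
  · filter_upwards [χ.eventuallyEq_one, e.open_baseSet.mem_nhds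
      (FiberBundle.mem_baseSet_trivializationAt' p)] with y hy hye i
    have hy' : χ y = 1 := hy
    rw [e.symmL_apply hye]
    simp [hy', hye, Trivialization.basisAt, b]

/-- The inverse trivialization at y is the derivative of the inverse chart, so this is the chain
rule. It carries derivatives along coordinate fields over to the Euclidean estimates. -/
lemma mvfderiv_symmL_eq_fderiv {p y : M}
    (hy : y ∈ (chartAt (EuclideanSpace ℝ (Fin n)) p).source) {h : M → ℝ}
    (hh : MDifferentiableAt (𝓡 n) 𝓘(ℝ, ℝ) h y) (v : EuclideanSpace ℝ (Fin n)) :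
    mvfderiv (𝓡 n) h y
      ((trivializationAt (EuclideanSpace ℝ (Fin n)) (TangentSpace (𝓡 n) : M → Type _) p).symmL
        ℝ y v) =
      fderiv ℝ (h ∘ (extChartAt (𝓡 n) p).symm) (extChartAt (𝓡 n) p y) v := by
  have hy' : y ∈ (extChartAt (𝓡 n) p).source := by rwa [extChartAt_source]
  have hinv : (extChartAt (𝓡 n) p).symm (extChartAt (𝓡 n) p y) = y :=
    (extChartAt (𝓡 n) p).left_inv hy'
  have hs : MDifferentiableAt 𝓘(ℝ, EuclideanSpace ℝ (Fin n)) (𝓡 n) (extChartAt (𝓡 n) p).symm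
      (extChartAt (𝓡 n) p y) := by
    have := mdifferentiableWithinAt_extChartAt_symm (I := 𝓡 n)
      ((extChartAt (𝓡 n) p).map_source hy')
    rwa [ModelWithCorners.Boundaryless.range_eq_univ, mdifferentiableWithinAt_univ] at this
  rw [TangentBundle.symmL_trivializationAt hy, ModelWithCorners.Boundaryless.range_eq_univ,
    mfderivWithin_univ]
  have := mvfderiv_comp_apply_of_eq (extChartAt (𝓡 n) p y) hh hs hinv v
  rw [← mfderiv_eq_fderiv]
  exact this.symm

lemma abs_apply_le_one {v : EuclideanSpace ℝ (Fin n)} (hv : ‖v‖ = 1) (i : Fin n) : |v i| ≤ 1 := by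
  have := PiLp.norm_apply_le v i
  rwa [hv, Real.norm_eq_abs] at this

lemma abs_sum_sum_mul_le {v : EuclideanSpace ℝ (Fin n)} (hv : ‖v‖ = 1) {a : Fin n → Fin n → ℝ}
    {B : ℝ} (ha : ∀ i j, |a i j| ≤ B) : |∑ i, ∑ j, v i * v j * a i j| ≤ n ^ 2 * B := by
  calc |∑ i, ∑ j, v i * v j * a i j| ≤ ∑ i : Fin n, ∑ j : Fin n, B := by
        refine (Finset.abs_sum_le_sum_abs _ _).trans (Finset.sum_le_sum fun i _ => ?_)
        refine (Finset.abs_sum_le_sum_abs _ _).trans (Finset.sum_le_sum fun j _ => ?_)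
        rw [abs_mul, abs_mul]
        have h1 : |v i| * |v j| ≤ 1 :=
          mul_le_one₀ (abs_apply_le_one hv i) (abs_nonneg _) (abs_apply_le_one hv j)
        calc |v i| * |v j| * |a i j| ≤ 1 * |a i j| := by gcongr
          _ ≤ B := by rw [one_mul]; exact ha i j
    _ = n ^ 2 * B := by simp; ring

lemma eventually_norm_le {X F : Type*} [TopologicalSpace X] [SeminormedAddCommGroup F]
    {ι : Type*} [Finite ι] {x : X} {f : ι → X → F} (hf : ∀ i, ContinuousAt (f i) x) :
    ∃ B : ℝ, 0 ≤ B ∧ ∀ᶠ y in 𝓝 x, ∀ i, ‖f i y‖ ≤ B := by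
  cases nonempty_fintype ι
  refine ⟨∑ i, (‖f i x‖ + 1), by positivity, Filter.eventually_all.2 fun i => ?_⟩
  have h1 : ∀ᶠ y in 𝓝 x, ‖f i y‖ < ‖f i x‖ + 1 :=
    (hf i).norm.eventually (gt_mem_nhds (lt_add_one _))
  filter_upwards [h1] with y hy
  exact hy.le.trans (Finset.single_le_sum (f := fun i => ‖f i x‖ + 1)
    (fun j _ => by positivity) (Finset.mem_univ i))

/-- In a chart, the second derivatives of `φ` with `g + ∇dφ > 0` are bounded below by
`-C (1 + |Dφ|)`, with `C` locally uniform and independent of `φ`. -/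
lemma exists_second_deriv_lower_bound [T2Space M]
    (cov : CovariantDerivative (𝓡 n) (EuclideanSpace ℝ (Fin n))
      (TangentSpace (𝓡 n) : M → Type _))
    (hcov : CovariantDerivative.ContMDiffCovariantDerivative cov ∞)
    (g : ContMDiffRiemannianMetric (𝓡 n) ∞ (EuclideanSpace ℝ (Fin n))
      (TangentSpace (𝓡 n) : M → Type _)) (p : M) :
    ∃ C : ℝ, 0 ≤ C ∧ ∀ᶠ y in 𝓝 p, ∀ φ : M → ℝ, ContMDiff (𝓡 n) 𝓘(ℝ, ℝ) 2 φ →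
      (∀ v : TangentSpace (𝓡 n) y, v ≠ 0 → 0 < deformedMetric cov g φ y v v) →
      ∀ v : EuclideanSpace ℝ (Fin n), ‖v‖ = 1 →
        -(C * (1 + ‖fderiv ℝ (φ ∘ (extChartAt (𝓡 n) p).symm) (extChartAt (𝓡 n) p y)‖)) ≤
          fderiv ℝ (fun z => fderiv ℝ (φ ∘ (extChartAt (𝓡 n) p).symm) z v)
            (extChartAt (𝓡 n) p y) v := by
  set e := trivializationAt (EuclideanSpace ℝ (Fin n)) (TangentSpace (𝓡 n) : M → Type _) p
  have hbase : e.baseSet = (chartAt (EuclideanSpace ℝ (Fin n)) p).source :=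
    TangentBundle.trivializationAt_baseSet p
  have hpe : p ∈ e.baseSet := FiberBundle.mem_baseSet_trivializationAt' p
  have hchart : ∀ {y : M}, y ∈ (chartAt (EuclideanSpace ℝ (Fin n)) p).source → ∀ {h : M → ℝ},
      MDifferentiableAt (𝓡 n) 𝓘(ℝ, ℝ) h y → ∀ v, mvfderiv (𝓡 n) h y (e.symmL ℝ y v) =
        fderiv ℝ (h ∘ (extChartAt (𝓡 n) p).symm) (extChartAt (𝓡 n) p y) v :=
    fun hy _ hh v => mvfderiv_symmL_eq_fderiv hy hh v
  obtain ⟨X, hX, hXe⟩ := exists_contMDiff_coordinate_fields (n := n) p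
  have hcovX : ∀ ij : Fin n × Fin n, ContMDiff (𝓡 n) (𝓡 n).tangent ∞
      (fun x => (⟨x, cov (X ij.1) x (X ij.2 x)⟩ : TangentBundle (𝓡 n) M)) := fun ij =>
    ContMDiff.clm_bundle_apply (b := fun x : M => x)
      (contMDiffOn_univ.1 (hcov.contMDiff.contMDiff (hX ij.1).contMDiffOn)) (hX ij.2)
  have hc : ∀ ij : Fin n × Fin n,
      ContinuousAt (fun x => (e ⟨x, cov (X ij.1) x (X ij.2 x)⟩).2) p := fun ij =>
    ((e.contMDiffAt_section_iff hpe).1 (hcovX ij p)).continuousAt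
  have hg : ∀ ij : Fin n × Fin n, ContinuousAt (fun x => g.inner x (X ij.1 x) (X ij.2 x)) p := by
    intro ij
    have h1 : ContMDiff (𝓡 n) ((𝓡 n).prod 𝓘(ℝ, ℝ)) ∞
        (fun x => TotalSpace.mk' ℝ (E := Bundle.Trivial M ℝ) x
          (g.inner x (X ij.1 x) (X ij.2 x))) :=
      ContMDiff.clm_bundle_apply₂ (b := fun x : M => x) (F₁ := EuclideanSpace ℝ (Fin n))
        (F₂ := EuclideanSpace ℝ (Fin n)) g.contMDiff (hX ij.1) (hX ij.2)
    have h2 := h1 p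
    simp only [contMDiffAt_totalSpace] at h2
    exact h2.2.continuousAt
  obtain ⟨B₁, hB₁, hcB⟩ := eventually_norm_le hc
  obtain ⟨B₂, hB₂, hgB⟩ := eventually_norm_le hg
  -- B₁ bounds the connection coefficients ∇_{X_j} X_i and B₂ the metric coefficients near p; a unit
  -- v has n² products v i * v j, each at most 1 in absolute value.
  refine ⟨n ^ 2 * B₁ + n ^ 2 * B₂, by positivity, ?_⟩
  filter_upwards [hcB, hgB, hXe.eventually_nhds, e.open_baseSet.mem_nhds hpe]
    with y hcy hgy hXy hye φ hφ hpos v hv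
  set φh := φ ∘ (extChartAt (𝓡 n) p).symm
  have hyc : y ∈ (chartAt (EuclideanSpace ℝ (Fin n)) p).source := hbase ▸ hye
  have hys : y ∈ (extChartAt (𝓡 n) p).source := by rwa [extChartAt_source]
  have hφd : MDifferentiable (𝓡 n) 𝓘(ℝ, ℝ) φ := hφ.mdifferentiable two_ne_zero
  -- Near y this is the field with constant coordinates v, so differentiating φ twice along it gives
  -- the plain second derivative in the chart.
  let W : (x : M) → TangentSpace (𝓡 n) x := fun x => ∑ i, v i • X i x
  have hWsm : ∀ i ∈ Finset.univ, ContMDiff (𝓡 n) (𝓡 n).tangent ∞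
      (fun x => (⟨x, v i • X i x⟩ : TangentBundle (𝓡 n) M)) := fun i _ =>
    (contMDiff_const (c := v i)).smul_section (hX i)
  have hW : MDifferentiableAt (𝓡 n) (𝓡 n).tangent
      (fun x => (⟨x, W x⟩ : TangentBundle (𝓡 n) M)) y :=
    (ContMDiff.sum_section hWsm).mdifferentiable (by simp) y
  have hWeq : ∀ᶠ z in 𝓝 y, W z = e.symmL ℝ z v := by
    filter_upwards [hXy] with z hz
    simp only [W, hz, ← map_smul, ← map_sum]
    congr 1
    conv_rhs => rw [← (EuclideanSpace.basisFun (Fin n) ℝ).sum_repr v]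
    simp
  have hWy : W y ≠ 0 := by
    rw [hWeq.self_of_nhds]
    intro h0
    have := e.continuousLinearMapAt_symmL (R := ℝ) hye v
    rw [h0, map_zero] at this
    rw [← this, norm_zero] at hv
    exact zero_ne_one hv
  have hsecond : mvfderiv (𝓡 n) (fun z => mvfderiv (𝓡 n) φ z (W z)) y (W y) =
      fderiv ℝ (fun z => fderiv ℝ φh z v) (extChartAt (𝓡 n) p y) v := by
    rw [hWeq.self_of_nhds, hchart hyc (mdifferentiableAt_mvfderiv_apply hφ hW)]
    congr 1
    refine Filter.EventuallyEq.fderiv_eq ?_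
    have htend : Filter.Tendsto (extChartAt (𝓡 n) p).symm (𝓝 (extChartAt (𝓡 n) p y)) (𝓝 y) := by
      have := continuousAt_extChartAt_symm' (I := 𝓡 n) hys
      rwa [ContinuousAt, (extChartAt (𝓡 n) p).left_inv hys] at this
    filter_upwards [htend.eventually hWeq, extChartAt_target_mem_nhds' (I := 𝓡 n)
      ((extChartAt (𝓡 n) p).map_source hys)] with z hz hzt
    have hzc : (extChartAt (𝓡 n) p).symm z ∈ (chartAt (EuclideanSpace ℝ (Fin n)) p).source := by
      rw [← extChartAt_source (𝓡 n)]; exact (extChartAt (𝓡 n) p).map_target hzt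
    simp only [Function.comp_apply]
    rw [hz, hchart hzc (hφd _), (extChartAt (𝓡 n) p).right_inv hzt]
  have hcovW : cov W y (W y) = ∑ i, ∑ j, (v i * v j) • cov (X i) y (X j y) := by
    have hadd : ∀ s : Finset (Fin n), cov (fun x => ∑ i ∈ s, v i • X i x) y =
        ∑ i ∈ s, v i • cov (X i) y := by
      intro s
      induction s using Finset.induction_on with
      | empty =>
        simp only [Finset.sum_empty]
        exact congrFun cov.zero y
      | insert a s ha ih =>
        simp only [Finset.sum_insert ha]
        rw [← ih, ← cov.isCovariantDerivativeOn.smul_const (s := Set.univ) (v a)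
          ((hX a).mdifferentiable (by simp) y)]
        exact cov.isCovariantDerivativeOn.add (s := Set.univ)
          ((hWsm a (Finset.mem_univ a)).mdifferentiable (by simp) y)
          ((ContMDiff.sum_section fun i _ => hWsm i (Finset.mem_univ i)).mdifferentiable
            (by simp) y)
    rw [show cov W y = _ from hadd Finset.univ]
    simp only [W, map_sum, map_smul, sum_apply, smul_apply,
      Finset.smul_sum, smul_smul]
    rw [Finset.sum_comm]
    simp only [mul_comm]
  have hfirst : ∀ i j, |mvfderiv (𝓡 n) φ y (cov (X i) y (X j y))| ≤
      ‖fderiv ℝ φh (extChartAt (𝓡 n) p y)‖ * B₁ := by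
    intro i j
    have h1 : cov (X i) y (X j y) = e.symmL ℝ y (e ⟨y, cov (X i) y (X j y)⟩).2 := by
      rw [e.symmL_apply hye, e.symm_apply_apply_mk hye]
    rw [h1, hchart hyc (hφd y), ← Real.norm_eq_abs]
    exact (ContinuousLinearMap.le_opNorm _ _).trans (by gcongr; exact hcy (i, j))
  have hp := hpos (W y) hWy
  -- Positivity on W now reads 0 < g(W, W) + D²φ(v, v) - dφ(∇_W W), whose outer terms are at most n²
  -- B₂ and n² B₁ |Dφ| in size.
  rw [deformedMetric, hessian_eq_of_extension cov hφ hW, hsecond, hcovW] at hp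
  have hgW : g.inner y (W y) (W y) = ∑ i, ∑ j, v i * v j * g.inner y (X i y) (X j y) := by
    simp only [W, map_sum, map_smul, sum_apply, smul_apply, smul_eq_mul, mul_assoc, Finset.mul_sum]
    rw [Finset.sum_comm]
    simp only [mul_left_comm]
  have hb1 := abs_sum_sum_mul_le hv hfirst
  have hb2 := abs_sum_sum_mul_le hv (a := fun i j => g.inner y (X i y) (X j y))
    (fun i j => hgy (i, j))
  rw [hgW] at hp
  simp only [map_sum, map_smul, smul_eq_mul] at hp
  have hD := norm_nonneg (fderiv ℝ φh (extChartAt (𝓡 n) p y))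
  have h3 := (abs_le.1 hb1).1
  have h4 := (abs_le.1 hb2).2
  have h5 : 0 ≤ (n : ℝ) ^ 2 * B₁ := by positivity
  have h6 : 0 ≤ (n : ℝ) ^ 2 * B₂ := by positivity
  nlinarith [mul_nonneg h6 hD]

/-- A local Harnack inequality for `1 + c - φ`, uniform over all `φ ≤ c` with `g + ∇dφ > 0`. -/
lemma exists_local_harnack [T2Space M]
    (cov : CovariantDerivative (𝓡 n) (EuclideanSpace ℝ (Fin n))
      (TangentSpace (𝓡 n) : M → Type _))
    (hcov : CovariantDerivative.ContMDiffCovariantDerivative cov ∞)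
    (g : ContMDiffRiemannianMetric (𝓡 n) ∞ (EuclideanSpace ℝ (Fin n))
      (TangentSpace (𝓡 n) : M → Type _)) (p : M) :
    ∃ A : ℝ, ∃ U ∈ 𝓝 p, ∀ φ : M → ℝ, ContMDiff (𝓡 n) 𝓘(ℝ, ℝ) 2 φ →
      (∀ (x : M) (v : TangentSpace (𝓡 n) x), v ≠ 0 → 0 < deformedMetric cov g φ x v v) →
      ∀ c : ℝ, (∀ x, φ x ≤ c) → ∀ x ∈ U, ∀ y ∈ U, 1 + c - φ x ≤ A * (1 + c - φ y) := by
  obtain ⟨C, hC, hev⟩ := exists_second_deriv_lower_bound cov hcov g p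
  obtain ⟨S, hS, hSbound⟩ := hev.exists_mem
  have hmem : (extChartAt (𝓡 n) p).target ∩ (extChartAt (𝓡 n) p).symm ⁻¹' S ∈
      𝓝 (extChartAt (𝓡 n) p p) := by
    refine Filter.inter_mem (extChartAt_target_mem_nhds p) ?_
    have h1 := continuousAt_extChartAt_symm (I := 𝓡 n) p
    rw [ContinuousAt, (extChartAt (𝓡 n) p).left_inv (mem_extChartAt_source p)] at h1
    exact h1 hS
  obtain ⟨r, hr, hball⟩ := Metric.nhds_basis_closedBall.mem_iff.1 hmem
  obtain ⟨A, hA⟩ := exists_le_mul_of_second_deriv_le (E := EuclideanSpace ℝ (Fin n)) hC hr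
  refine ⟨A, (extChartAt (𝓡 n) p).source ∩ (extChartAt (𝓡 n) p) ⁻¹'
    Metric.closedBall (extChartAt (𝓡 n) p p) (r / 2), Filter.inter_mem
      (extChartAt_source_mem_nhds p) ((continuousAt_extChartAt p)
        (Metric.closedBall_mem_nhds _ (half_pos hr))), fun φ hφ hpos c hc x hx y hy => ?_⟩
  set φh := φ ∘ (extChartAt (𝓡 n) p).symm with hφh
  have hsm : ∀ z ∈ Metric.closedBall (extChartAt (𝓡 n) p p) r, ContDiffAt ℝ 2 φh z := by
    intro z hz
    have h1 : ContMDiffOn 𝓘(ℝ, EuclideanSpace ℝ (Fin n)) 𝓘(ℝ, ℝ) 2 φh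
        (extChartAt (𝓡 n) p).target :=
      hφ.comp_contMDiffOn (contMDiffOn_extChartAt_symm p)
    exact (contMDiffOn_iff_contDiffOn.1 h1).contDiffAt
      ((isOpen_extChartAt_target p).mem_nhds (hball hz).1)
  have hfd : ∀ z ∈ Metric.closedBall (extChartAt (𝓡 n) p p) r,
      DifferentiableAt ℝ (fderiv ℝ φh) z := fun z hz =>
    ((hsm z hz).fderiv_right (m := 1) le_rfl).differentiableAt one_ne_zero
  have hfderiv : fderiv ℝ (fun z => 1 + c - φh z) = fun z => -fderiv ℝ φh z := by
    ext1 z; exact fderiv_const_sub _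
  have key := hA (fun z => 1 + c - φh z) (extChartAt (𝓡 n) p p)
    (fun z hz => ((hsm z hz).differentiableAt two_ne_zero).const_sub _)
    (by rw [hfderiv]; exact fun z hz => (hfd z hz).continuousAt.neg.continuousWithinAt)
    (fun z hz => by have := hc ((extChartAt (𝓡 n) p).symm z); simp only [hφh, Function.comp_apply]
                    linarith)
    (fun z hz v hv => by
      obtain ⟨hzt, hzs⟩ := hball hz
      have hlow := hSbound _ hzs φ hφ (hpos _) v hv
      rw [(extChartAt (𝓡 n) p).right_inv hzt] at hlow
      refine ⟨-(fderiv ℝ (fun z => fderiv ℝ φh z v) z v), ?_, ?_⟩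
      · simp only [hfderiv, neg_apply]
        refine HasDerivAt.neg ?_
        have h1 : HasFDerivAt (fun z => fderiv ℝ φh z v) (fderiv ℝ (fun z => fderiv ℝ φh z v) z)
            (z + (0 : ℝ) • v) := by
          rw [zero_smul, add_zero]
          exact ((hfd z hz).clm_apply (differentiableAt_const v)).hasFDerivAt
        have h2 : HasDerivAt (fun s : ℝ => z + s • v) v 0 := by
          simpa using ((hasDerivAt_id (0 : ℝ)).smul_const v).const_add z
        exact h1.comp_hasDerivAt (0 : ℝ) h2
      · rw [hfderiv, norm_neg]
        linarith)
    _ hx.2 _ hy.2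
  simpa only [hφh, Function.comp_apply, (extChartAt (𝓡 n) p).left_inv hx.1,
    (extChartAt (𝓡 n) p).left_inv hy.1] using key

end

/-! ### Chaining local Harnack inequalities. -/

/-- Local Harnack inequalities chain to a global one on a compact connected space. -/
lemma exists_harnack_of_local {X : Type*} [TopologicalSpace X] [CompactSpace X] [ConnectedSpace X]
    {𝓕 : Set (X → ℝ)} (hpos : ∀ F ∈ 𝓕, ∀ x, 0 ≤ F x)
    (hloc : ∀ p : X, ∃ A : ℝ, ∃ U ∈ 𝓝 p, ∀ F ∈ 𝓕, ∀ x ∈ U, ∀ y ∈ U, F x ≤ A * F y) :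
    ∃ A : ℝ, ∀ F ∈ 𝓕, ∀ x y, F x ≤ A * F y := by
  -- Nonnegative constants are needed to multiply inequalities along a chain.
  have hloc' : ∀ p : X, ∃ A : ℝ, 0 ≤ A ∧ ∃ U ∈ 𝓝 p, ∀ F ∈ 𝓕, ∀ x ∈ U, ∀ y ∈ U,
      F x ≤ A * F y := by
    intro p
    obtain ⟨A, U, hU, h⟩ := hloc p
    exact ⟨max A 0, le_max_right _ _, U, hU, fun F hF x hx y hy => (h F hF x hx y hy).trans
      (mul_le_mul_of_nonneg_right (le_max_left _ _) (hpos F hF y))⟩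
  -- Comparability of two points holds both ways between a point and its neighbours and is
  -- transitive, so connectedness gives it for every pair, with a constant depending on the pair.
  have hpair : ∀ x y : X, ∃ A : ℝ, 0 ≤ A ∧ ∀ F ∈ 𝓕, F x ≤ A * F y := by
    refine PreconnectedSpace.induction₂' _ (fun x => ?_) ⟨?_⟩
    · obtain ⟨A, hA, U, hU, h⟩ := hloc' x
      filter_upwards [hU] with y hy
      exact ⟨⟨A, hA, fun F hF => h F hF x (mem_of_mem_nhds hU) y hy⟩,
        ⟨A, hA, fun F hF => h F hF y hy x (mem_of_mem_nhds hU)⟩⟩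
    · rintro x y z ⟨A, hA, h⟩ ⟨B, hB, h'⟩
      refine ⟨A * B, mul_nonneg hA hB, fun F hF => (h F hF).trans ?_⟩
      rw [mul_assoc]
      exact mul_le_mul_of_nonneg_left (h' F hF) hA
  obtain ⟨x₀⟩ : Nonempty X := inferInstance
  -- Comparing with one base point in both directions makes the property stable under finite unions,
  -- so compactness removes the dependence on x.
  have hunif : ∃ A : ℝ, 0 ≤ A ∧ ∀ F ∈ 𝓕, ∀ x ∈ (Set.univ : Set X),
      F x ≤ A * F x₀ ∧ F x₀ ≤ A * F x := by
    refine isCompact_univ.induction_on (p := fun s => ∃ A : ℝ, 0 ≤ A ∧ ∀ F ∈ 𝓕, ∀ x ∈ s,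
      F x ≤ A * F x₀ ∧ F x₀ ≤ A * F x) ⟨0, le_rfl, by simp⟩ ?_ ?_ ?_
    · rintro s t hst ⟨A, hA, h⟩
      exact ⟨A, hA, fun F hF x hx => h F hF x (hst hx)⟩
    · rintro s t ⟨A, hA, h⟩ ⟨B, hB, h'⟩
      refine ⟨max A B, le_max_of_le_left hA, fun F hF x hx => ?_⟩
      rcases hx with hx | hx
      · exact (h F hF x hx).imp
          (fun q => q.trans (mul_le_mul_of_nonneg_right (le_max_left _ _) (hpos F hF _)))
          (fun q => q.trans (mul_le_mul_of_nonneg_right (le_max_left _ _) (hpos F hF _)))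
      · exact (h' F hF x hx).imp
          (fun q => q.trans (mul_le_mul_of_nonneg_right (le_max_right _ _) (hpos F hF _)))
          (fun q => q.trans (mul_le_mul_of_nonneg_right (le_max_right _ _) (hpos F hF _)))
    · intro p _
      obtain ⟨A, hA, U, hU, h⟩ := hloc' p
      obtain ⟨B, hB, h1⟩ := hpair p x₀
      obtain ⟨D, hD, h2⟩ := hpair x₀ p
      have hp := mem_of_mem_nhds hU
      refine ⟨U, mem_nhdsWithin_of_mem_nhds hU, max (A * B) (D * A),
        le_max_of_le_left (mul_nonneg hA hB), fun F hF x hx => ⟨?_, ?_⟩⟩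
      · calc F x ≤ A * F p := h F hF x hx p hp
          _ ≤ A * (B * F x₀) := mul_le_mul_of_nonneg_left (h1 F hF) hA
          _ = A * B * F x₀ := by ring
          _ ≤ _ := mul_le_mul_of_nonneg_right (le_max_left _ _) (hpos F hF _)
      · calc F x₀ ≤ D * F p := h2 F hF
          _ ≤ D * (A * F x) := mul_le_mul_of_nonneg_left (h F hF p hp x hx) hD
          _ = D * A * F x := by ring
          _ ≤ _ := mul_le_mul_of_nonneg_right (le_max_right _ _) (hpos F hF _)
  obtain ⟨A, hA, h⟩ := hunif
  refine ⟨A * A, fun F hF x y => ((h F hF x trivial).1).trans ?_⟩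
  rw [mul_assoc]
  exact mul_le_mul_of_nonneg_left (h F hF y trivial).2 hA

end HessianGeometry

/-! ### The oscillation bound. -/

/-- The oscillation bound. The convexity `g + ∇dφ > 0` by itself already forces it, so the constant
can be chosen independently of `K`. -/
theorem theorem5p4 {n : ℕ} {M : Type*} [TopologicalSpace M]
    [ChartedSpace (EuclideanSpace ℝ (Fin n)) M] [IsManifold (𝓡 n) ∞ M]
    [T2Space M] [CompactSpace M] [ConnectedSpace M]
    (cov : CovariantDerivative (𝓡 n) (EuclideanSpace ℝ (Fin n))
      (TangentSpace (𝓡 n) : M → Type _))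
    (g : ContMDiffRiemannianMetric (𝓡 n) ∞ (EuclideanSpace ℝ (Fin n))
      (TangentSpace (𝓡 n) : M → Type _))
    (hM : HessianGeometry.IsHessianManifold cov g) (K : ℝ) :
    ∃ C : ℝ, ∀ φ f : M → ℝ,
      ContMDiff (𝓡 n) 𝓘(ℝ, ℝ) 2 φ →
      (∀ (x : M) (v : TangentSpace (𝓡 n) x), v ≠ 0 →
        0 < HessianGeometry.deformedMetric cov g φ x v v) →
      HessianGeometry.SolvesMongeAmpere cov g φ f →
      (∀ x : M, |f x| ≤ K) →
      (⨆ x : M, φ x) - (⨅ x : M, φ x) ≤ C := by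
  obtain ⟨A, hA⟩ := HessianGeometry.exists_harnack_of_local
    (𝓕 := {F : M → ℝ | ∃ φ : M → ℝ, ContMDiff (𝓡 n) 𝓘(ℝ, ℝ) 2 φ ∧
      (∀ (x : M) (v : TangentSpace (𝓡 n) x), v ≠ 0 →
        0 < HessianGeometry.deformedMetric cov g φ x v v) ∧
      ∃ c : ℝ, (∀ x, φ x ≤ c) ∧ F = fun x => 1 + c - φ x})
    (by
      rintro _ ⟨φ, -, -, c, hc, rfl⟩ x
      have := hc x
      simp only []
      linarith)
    (fun p => by
      obtain ⟨A, U, hU, h⟩ := HessianGeometry.exists_local_harnack cov hM.smooth g p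
      refine ⟨A, U, hU, ?_⟩
      rintro _ ⟨φ, hφ, hpos, c, hc, rfl⟩
      exact h φ hφ hpos c hc)
  -- Since A serves every upper bound c, take c = φ z with z a maximum point: then F z = 1 and 1 + φ
  -- z - φ x ≤ A.
  refine ⟨A - 1, fun φ f hφ hpos _ _ => ?_⟩
  obtain ⟨z, -, hz⟩ := isCompact_univ.exists_isMaxOn Set.univ_nonempty hφ.continuous.continuousOn
  have hz' : ∀ x, φ x ≤ φ z := fun x => hz (Set.mem_univ x)
  have hsup : (⨆ x, φ x) ≤ φ z := ciSup_le hz'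
  have hinf : φ z - (A - 1) ≤ ⨅ x, φ x := le_ciInf fun x => by
    have := hA _ ⟨φ, hφ, hpos, φ z, hz', rfl⟩ x z
    simp only [add_sub_cancel_right, mul_one] at this
    linarith
  linarith
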